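/- Let $n\ge 0$ be an integer. A subgroup of $\mathrm{GL}(n,\mathbb{C})$ is called \emph{unipotent} if it is conjugate in $\mathrm{GL}(n,\mathbb{C})$ into the group of upper triangular matrices with ones along the diagonal, and \emph{virtually unipotent} if it has a finite index subgroup that is unipotent. A group is \emph{torsion free} if its only element of finite order is the identity. Let $\Gamma$ be a subgroup of $\mathrm{GL}(n,\mathbb{Z})$ that is torsion free and virtually unipotent (as a subgroup of $\mathrm{GL}(n,\mathbb{C})$). Then there exists a torsion free, finite index subgroup $\Lambda_0$ of $\mathrm{GL}(n,\mathbb{Z})$ such that $\Gamma\subseteq\Lambda_0$. -/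

import Mathlib

/-- A group is torsion free if its only element of finite order is the identity. (Mathlib's
`IsMulTorsionFree` asks for uniqueness of roots, which is strictly stronger for
noncommutative groups.) -/
def TorsionFreeGroup (G : Type*) [Group G] : Prop :=
  ∀ g : G, IsOfFinOrder g → g = 1

/-- Upper triangular matrices with ones along the diagonal. -/
def IsUpperUnitriangular {n : ℕ} (M : Matrix (Fin n) (Fin n) ℂ) : Prop :=
  M.BlockTriangular id ∧ ∀ i, M i i = 1

/-- A subgroup of `GL(n, ℂ)` is unipotent if it is conjugate in `GL(n, ℂ)` into the group of
upper triangular matrices with ones along the diagonal. -/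
def IsUnipotentSubgroup {n : ℕ} (H : Subgroup (GL (Fin n) ℂ)) : Prop :=
  ∃ g : GL (Fin n) ℂ, ∀ γ ∈ H,
    IsUpperUnitriangular ((g * γ * g⁻¹ : GL (Fin n) ℂ) : Matrix (Fin n) (Fin n) ℂ)

/-- A subgroup of `GL(n, ℂ)` is virtually unipotent if it has a finite index subgroup that is
unipotent. -/
def IsVirtuallyUnipotent {n : ℕ} (Γ : Subgroup (GL (Fin n) ℂ)) : Prop :=
  ∃ H : Subgroup (GL (Fin n) ℂ), H ≤ Γ ∧ H.IsFiniteRelIndex Γ ∧ IsUnipotentSubgroup H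

/-- The inclusion `GL(n, ℤ) → GL(n, ℂ)`. -/
def intToComplexGL (n : ℕ) : GL (Fin n) ℤ →* GL (Fin n) ℂ :=
  Matrix.GeneralLinearGroup.map (Int.castRingHom ℂ)

/-! The group sought is `Λ₀ = Γ · Γ(m)`, with `Γ(m)` a deep congruence subgroup and `3 ∣ m`. Let `x
= γ l` in it have finite order and let `r = |GL(n, ℤ/3)|`. Then `x ^ r` is torsion in `Γ(3)`, hence
trivial (Minkowski), so `γ ^ e ≡ x ^ e = 1` mod `m` for every multiple `e` of `r`. If this forces `γ
∈ Γ(3)`, then `x ∈ Γ(3)` and `x = 1`.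

So in `Γ` an `e`-th power close to `1` must come from an element close to `1`
(`exists_level_of_torsionFree`). Take `e` also divisible by the index of a normal unipotent `U ≤ Γ`,
so that `g ^ e ∈ U`. Filter `U` by normal subgroups `V i` with torsion free abelian quotients. If `d
^ e ∈ V i` is close to `1`, it is modulo `V (i + 1)` the `e`-th power of some `b ∈ V i` close to `1`
(`exists_level_pow`), and `d * b⁻¹` has its `e`-th power in `V (i + 1)` (`div_pow_mem`). At the end
of the filtration, `g` is close to some `d` with `d ^ e = 1`; torsion freeness gives `d = 1`. -/

/-! ### Congruence subgroups and Minkowski's lemma -/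

/-- The principal congruence subgroup of level `m` in `GL(n, ℤ)`. -/
def congruenceSubgroup (n m : ℕ) : Subgroup (GL (Fin n) ℤ) :=
  (Matrix.GeneralLinearGroup.map (n := Fin n) (Int.castRingHom (ZMod m))).ker

instance congruenceSubgroup_normal (n m : ℕ) : (congruenceSubgroup n m).Normal :=
  MonoidHom.normal_ker _

theorem mem_congruenceSubgroup_iff {n m : ℕ} {g : GL (Fin n) ℤ} :
    g ∈ congruenceSubgroup n m ↔
      ∃ Y : Matrix (Fin n) (Fin n) ℤ, (g : Matrix (Fin n) (Fin n) ℤ) - 1 = (m : ℤ) • Y := by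
  have key : g ∈ congruenceSubgroup n m ↔
      ∀ i j, (m : ℤ) ∣ ((g : Matrix (Fin n) (Fin n) ℤ) - 1) i j := by
    rw [congruenceSubgroup, MonoidHom.mem_ker, Matrix.GeneralLinearGroup.ext_iff]
    refine forall_congr' fun i => forall_congr' fun j => ?_
    rw [← CharP.intCast_eq_zero_iff (ZMod m) m]
    simp [Matrix.one_apply, sub_eq_zero]
  rw [key]
  constructor
  · intro h
    choose Y hY using h
    exact ⟨Matrix.of Y, by ext i j; simpa using hY i j⟩
  · rintro ⟨Y, hY⟩ i j
    exact ⟨Y i j, by rw [hY]; simp⟩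

theorem congruenceSubgroup_le_of_dvd {n m m' : ℕ} (h : m ∣ m') :
    congruenceSubgroup n m' ≤ congruenceSubgroup n m := by
  intro g hg
  obtain ⟨Y, hY⟩ := mem_congruenceSubgroup_iff.1 hg
  obtain ⟨k, rfl⟩ := h
  exact mem_congruenceSubgroup_iff.2 ⟨(k : ℤ) • Y, by rw [hY, smul_smul]; push_cast; rfl⟩

instance congruenceSubgroup_finiteIndex (n m : ℕ) [NeZero m] :
    (congruenceSubgroup n m).FiniteIndex := by
  unfold congruenceSubgroup
  infer_instance

theorem pow_card_mem_congruenceSubgroup {n m : ℕ} (g : GL (Fin n) ℤ) :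
    g ^ Nat.card (GL (Fin n) (ZMod m)) ∈ congruenceSubgroup n m := by
  rw [congruenceSubgroup, MonoidHom.mem_ker, map_pow, pow_card_eq_one']

/-- An integer matrix congruent to a unit scalar modulo `3` is a non-zero-divisor. -/
theorem eq_zero_of_mul_eq_zero_of_congr {n : ℕ} {a : ℤ} (ha : IsCoprime a 3)
    {x s y : Matrix (Fin n) (Fin n) ℤ} (hs : s = a • (1 : Matrix (Fin n) (Fin n) ℤ) + (3 : ℤ) • y)
    (h : x * s = 0) : x = 0 := by
  have hdet : s.det ≠ 0 := by
    intro h0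
    have h1 : (s.map (Int.castRingHom (ZMod 3))).det = 0 := by
      rw [← RingHom.mapMatrix_apply, ← RingHom.map_det, h0, map_zero]
    have h2 : s.map (Int.castRingHom (ZMod 3)) = (a : ZMod 3) • 1 := by
      ext i j
      have h3 : (3 : ZMod 3) = 0 := by decide
      simp only [hs, Matrix.map_apply, Matrix.add_apply, Matrix.smul_apply, Matrix.one_apply]
      split_ifs <;> simp [h3]
    rw [h2, Matrix.det_smul, Matrix.det_one, mul_one] at h1
    have : Fact (Nat.Prime 3) := ⟨Nat.prime_three⟩
    have h4 : (a : ZMod 3) = 0 := eq_zero_of_pow_eq_zero h1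
    rw [CharP.intCast_eq_zero_iff (ZMod 3) 3] at h4
    exact absurd (ha.isUnit_of_dvd' h4 dvd_rfl) (by decide)
  have h5 : x * s * s.adjugate = 0 := by rw [h, zero_mul]
  rw [mul_assoc, Matrix.mul_adjugate, mul_smul_comm, mul_one] at h5
  exact (smul_eq_zero.1 h5).resolve_left hdet

/-- In `0 = x ^ p - 1 = (x - 1) * (1 + x + ⋯ + x ^ (p - 1))` the second factor is `p` modulo `3`, a
unit if `p ≠ 3`. For `p = 3` it is `3` times a matrix congruent to `1`. Either way it can be
cancelled. -/
theorem eq_one_of_pow_prime_eq_one {n p : ℕ} (hp : p.Prime) {g : GL (Fin n) ℤ}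
    (hg : g ∈ congruenceSubgroup n 3) (h : g ^ p = 1) : g = 1 := by
  obtain ⟨Y, hY⟩ := mem_congruenceSubgroup_iff.1 hg
  set x : Matrix (Fin n) (Fin n) ℤ := (g : Matrix (Fin n) (Fin n) ℤ) with hx
  have hx1 : x = 1 + (3 : ℤ) • Y := by rw [← sub_add_cancel x 1, hY, add_comm]; rfl
  have hpow : x ^ p = 1 := by rw [hx, ← Units.val_pow_eq_pow_val, h, Units.val_one]
  have hgeom : (x - 1) * ∑ i ∈ Finset.range p, x ^ i = 0 := by
    rw [mul_geom_sum, hpow, sub_self]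
  suffices x - 1 = 0 from Units.ext (sub_eq_zero.1 this)
  by_cases hp3 : p = 3
  · subst hp3
    have hsum : ∑ i ∈ Finset.range 3, x ^ i =
        (3 : ℤ) • ((1 : ℤ) • (1 : Matrix (Fin n) (Fin n) ℤ) + (3 : ℤ) • (Y + Y * Y)) := by
      simp only [Finset.sum_range_succ, Finset.sum_range_zero, hx1, zsmul_eq_mul]
      push_cast
      noncomm_ring
    rw [hsum, mul_smul_comm] at hgeom
    exact eq_zero_of_mul_eq_zero_of_congr isCoprime_one_left rfl
      ((smul_eq_zero.1 hgeom).resolve_left (by norm_num))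
  · have hex : ∀ i : ℕ, ∃ Z, x ^ i = 1 + (3 : ℤ) • Z := by
      intro i
      obtain ⟨Z, hZ⟩ := mem_congruenceSubgroup_iff.1 (pow_mem hg i)
      refine ⟨Z, ?_⟩
      rw [Units.val_pow_eq_pow_val] at hZ
      rw [← sub_add_cancel (x ^ i) 1, hZ, add_comm]; rfl
    choose Z hZ using hex
    refine eq_zero_of_mul_eq_zero_of_congr (a := p) (y := ∑ i ∈ Finset.range p, Z i) ?_ ?_ hgeom
    · exact_mod_cast Nat.isCoprime_iff_coprime.2 ((Nat.coprime_primes hp Nat.prime_three).2 hp3)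
    · simp [hZ, Finset.sum_add_distrib, Finset.smul_sum]

/-- Minkowski: the principal congruence subgroup of level `3` has no torsion. -/
theorem eq_one_of_mem_congruenceSubgroup_three {n : ℕ} (k : ℕ) (hk : k ≠ 0) (g : GL (Fin n) ℤ)
    (hg : g ∈ congruenceSubgroup n 3) (h : g ^ k = 1) : g = 1 := by
  induction k using Nat.recOnMul generalizing g with
  | zero => exact absurd rfl hk
  | one => simpa using h
  | prime p hp => exact eq_one_of_pow_prime_eq_one hp hg h
  | mul a b iha ihb =>
    rw [pow_mul] at h
    exact iha (left_ne_zero_of_mul hk) g hg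
      (ihb (right_ne_zero_of_mul hk) _ (pow_mem hg a) h)

/-! ### Unipotent filtrations and approximate roots -/

/-- A uniform bound for the torsion of a quotient of a finitely generated abelian group. -/
theorem exists_ne_zero_nsmul_mem {M : Type*} [AddCommGroup M] [Module.Finite ℤ M]
    (A : AddSubgroup M) :
    ∃ t : ℕ, t ≠ 0 ∧ ∀ (c : ℕ) (y : M), c ≠ 0 → c • y ∈ A → t • y ∈ A := by
  have : Module.Finite ℤ (M ⧸ A.toIntSubmodule) := inferInstance
  have : Finite (Submodule.torsion ℤ (M ⧸ A.toIntSubmodule)) :=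
    Module.finite_of_fg_torsion _ (Submodule.torsion_isTorsion)
  refine ⟨Nat.card (Submodule.torsion ℤ (M ⧸ A.toIntSubmodule)), Nat.card_pos.ne', ?_⟩
  intro c y hc hy
  let q : M ⧸ A.toIntSubmodule := Submodule.Quotient.mk y
  have hq : q ∈ Submodule.torsion ℤ (M ⧸ A.toIntSubmodule) := by
    rw [Submodule.mem_torsion_iff]
    refine ⟨⟨(c : ℤ), mem_nonZeroDivisors_of_ne_zero (by exact_mod_cast hc)⟩, ?_⟩
    change (c : ℤ) • q = 0
    rw [natCast_zsmul]
    exact (Submodule.Quotient.mk_eq_zero _).2 hy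
  have := card_nsmul_eq_zero' (x := (⟨q, hq⟩ : Submodule.torsion ℤ (M ⧸ A.toIntSubmodule)))
  have := congrArg Subtype.val this
  exact (Submodule.Quotient.mk_eq_zero _).1 this

/-- A filtration of the integer matrices by which the subgroup `U` acts unipotently. -/
structure UnipotentFiltration {n : ℕ} {G : Type*} [Group G] (ρ : G →* GL (Fin n) ℤ)
    (U : Subgroup G) where
  D : ℕ → AddSubgroup (Matrix (Fin n) (Fin n) ℤ)
  sub_one_mem : ∀ u ∈ U, (ρ u : Matrix (Fin n) (Fin n) ℤ) - 1 ∈ D 0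
  succ_le : ∀ i, D (i + 1) ≤ D i
  mul_mem_succ : ∀ i, ∀ x ∈ D i, ∀ y ∈ D 0, x * y ∈ D (i + 1)
  conj_mem : ∀ i (g : G), ∀ x ∈ D i, (ρ g : Matrix (Fin n) (Fin n) ℤ) * x * (ρ g⁻¹) ∈ D i
  mem_of_nsmul_mem : ∀ i (c : ℕ) x, c ≠ 0 → c • x ∈ D i → x ∈ D i
  length : ℕ
  eq_zero : ∀ x ∈ D length, x = 0

namespace UnipotentFiltration

variable {n : ℕ} {G : Type*} [Group G] {ρ : G →* GL (Fin n) ℤ} {U : Subgroup G}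
  (F : UnipotentFiltration ρ U)

theorem mul_sub_one (u v : G) : (ρ (u * v) : Matrix (Fin n) (Fin n) ℤ) - 1 =
    ((ρ u : Matrix (Fin n) (Fin n) ℤ) - 1) + ((ρ v : Matrix (Fin n) (Fin n) ℤ) - 1) +
    ((ρ u : Matrix (Fin n) (Fin n) ℤ) - 1) * ((ρ v : Matrix (Fin n) (Fin n) ℤ) - 1) := by
  rw [map_mul, Units.val_mul]
  noncomm_ring

theorem inv_sub_one (u : G) : (ρ u⁻¹ : Matrix (Fin n) (Fin n) ℤ) - 1 =
    -((ρ u : Matrix (Fin n) (Fin n) ℤ) - 1)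
    - ((ρ u : Matrix (Fin n) (Fin n) ℤ) - 1) * ((ρ u⁻¹ : Matrix (Fin n) (Fin n) ℤ) - 1) := by
  have := mul_sub_one (ρ := ρ) u u⁻¹
  rw [mul_inv_cancel, map_one, Units.val_one, sub_self] at this
  rw [← sub_eq_zero]
  exact (by abel : _ = _).trans this.symm

/-- The filtration of `U` induced by the filtration of the matrices. -/
def V (i : ℕ) : Subgroup G where
  carrier := {u | u ∈ U ∧ (ρ u : Matrix (Fin n) (Fin n) ℤ) - 1 ∈ F.D i}
  one_mem' := ⟨one_mem _, by simp⟩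
  mul_mem' := by
    rintro a b ⟨ha, ha'⟩ ⟨hb, hb'⟩
    refine ⟨mul_mem ha hb, ?_⟩
    rw [mul_sub_one]
    exact add_mem (add_mem ha' hb')
      (F.succ_le i (F.mul_mem_succ i _ ha' _ (F.sub_one_mem b hb)))
  inv_mem' := by
    rintro a ⟨ha, ha'⟩
    refine ⟨inv_mem ha, ?_⟩
    rw [inv_sub_one]
    exact sub_mem (neg_mem ha')
      (F.succ_le i (F.mul_mem_succ i _ ha' _ (F.sub_one_mem _ (inv_mem ha))))

theorem mem_V {i : ℕ} {u : G} :
    u ∈ F.V i ↔ u ∈ U ∧ (ρ u : Matrix (Fin n) (Fin n) ℤ) - 1 ∈ F.D i := Iff.rfl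

theorem mem_V_zero {u : G} (hu : u ∈ U) : u ∈ F.V 0 := ⟨hu, F.sub_one_mem u hu⟩

theorem V_normal [hU : U.Normal] (i : ℕ) : (F.V i).Normal where
  conj_mem u hu g := by
    refine ⟨hU.conj_mem u hu.1 g, ?_⟩
    convert F.conj_mem i g _ hu.2 using 1
    rw [mul_sub, sub_mul, mul_one, map_mul, map_mul, Units.val_mul, Units.val_mul,
      ← Units.val_mul (ρ g) (ρ g⁻¹), ← map_mul, mul_inv_cancel, map_one, Units.val_one]

/-- The error is `(u - 1) * (v - 1)`, one step deeper. Thus `u ↦ u - 1` embeds `V i / V (i + 1)` in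
the torsion free group `D i / D (i + 1)`. -/
theorem mul_sub_one_sub_mem {i : ℕ} {u v : G} (hu : u ∈ F.V i) (hv : v ∈ F.V i) :
    ((ρ (u * v) : Matrix (Fin n) (Fin n) ℤ) - 1) -
      (((ρ u : Matrix (Fin n) (Fin n) ℤ) - 1) + ((ρ v : Matrix (Fin n) (Fin n) ℤ) - 1))
      ∈ F.D (i + 1) := by
  rw [mul_sub_one, add_sub_cancel_left]
  exact F.mul_mem_succ i _ hu.2 _ (F.sub_one_mem v hv.1)

theorem pow_sub_one_sub_mem {i : ℕ} {u : G} (hu : u ∈ F.V i) (c : ℕ) :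
    ((ρ (u ^ c) : Matrix (Fin n) (Fin n) ℤ) - 1) -
      c • ((ρ u : Matrix (Fin n) (Fin n) ℤ) - 1) ∈ F.D (i + 1) := by
  induction c with
  | zero => simp
  | succ c ih =>
    have := add_mem ih (F.mul_sub_one_sub_mem (pow_mem hu c) hu)
    convert this using 1
    rw [pow_succ, succ_nsmul]
    abel

theorem inv_mul_mem_iff {i : ℕ} {u v : G} (hu : u ∈ F.V i) (hv : v ∈ F.V i) :
    u⁻¹ * v ∈ F.V (i + 1) ↔
      (ρ v : Matrix (Fin n) (Fin n) ℤ) - ρ u ∈ F.D (i + 1) := by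
  have h1 := F.mul_sub_one_sub_mem hu (mul_mem (inv_mem hu) hv)
  rw [mul_inv_cancel_left] at h1
  have h2 : (ρ v : Matrix (Fin n) (Fin n) ℤ) - ρ u =
    ((ρ v : Matrix (Fin n) (Fin n) ℤ) - 1 - (((ρ u : Matrix (Fin n) (Fin n) ℤ) - 1) +
      ((ρ (u⁻¹ * v) : Matrix (Fin n) (Fin n) ℤ) - 1))) +
      ((ρ (u⁻¹ * v) : Matrix (Fin n) (Fin n) ℤ) - 1) := by abel
  rw [h2, AddSubgroup.add_mem_cancel_left _ h1, mem_V]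
  exact and_iff_right (mul_mem (inv_mem hu.1) hv.1)

/-- The quotients of successive terms of the filtration have unique roots. -/
theorem inv_mul_mem_of_pow {i e : ℕ} (he : e ≠ 0) {u v : G} (hu : u ∈ F.V i) (hv : v ∈ F.V i)
    (h : (u ^ e)⁻¹ * v ^ e ∈ F.V (i + 1)) : u⁻¹ * v ∈ F.V (i + 1) := by
  rw [F.inv_mul_mem_iff (pow_mem hu e) (pow_mem hv e)] at h
  rw [F.inv_mul_mem_iff hu hv]
  refine F.mem_of_nsmul_mem _ e _ he ?_
  have := add_mem (sub_mem h (F.pow_sub_one_sub_mem hv e)) (F.pow_sub_one_sub_mem hu e)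
  convert this using 1
  simp only [nsmul_sub]
  abel

/-- Modulo `V (i + 1)`, `d` commutes with `d ^ e = b ^ e`, so `b` and `d * b * d⁻¹` have equal
`e`-th powers. Uniqueness of roots makes `d` and `b` commute. -/
theorem div_pow_mem [U.Normal] {i e : ℕ} (he : e ≠ 0) {d b : G}
    (hb : b ∈ F.V i) (h : (d ^ e)⁻¹ * b ^ e ∈ F.V (i + 1)) :
    (d * b⁻¹) ^ e ∈ F.V (i + 1) := by
  have := F.V_normal i
  have := F.V_normal (i + 1)
  let π := QuotientGroup.mk' (F.V (i + 1))
  have hπ : ∀ x y : G, π x = π y ↔ x⁻¹ * y ∈ F.V (i + 1) := fun x y => QuotientGroup.eq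
  have hpow : π d ^ e = π b ^ e := by
    rw [← map_pow, ← map_pow]; exact (hπ _ _).2 h
  have hconj : π b = π (d * b * d⁻¹) := by
    rw [hπ]
    refine F.inv_mul_mem_of_pow he hb (Subgroup.Normal.conj_mem ‹_› b hb d) ?_
    rw [← hπ, conj_pow, map_mul, map_mul, map_pow, map_inv, ← hpow, ← pow_succ', pow_succ,
      mul_inv_cancel_right]
  have hcomm : Commute (π d) (π b) := by
    rw [map_mul, map_mul, map_inv, eq_mul_inv_iff_mul_eq] at hconj
    exact hconj.symm
  have : π ((d * b⁻¹) ^ e) = 1 := by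
    rw [map_pow, map_mul, map_inv, hcomm.inv_right.mul_pow, hpow, inv_pow, mul_inv_cancel]
  exact (QuotientGroup.eq_one_iff _).1 this

/-- Integer matrices that agree with an element of `V i` modulo `D (i + 1)`. -/
def graded (i : ℕ) : AddSubgroup (Matrix (Fin n) (Fin n) ℤ) where
  carrier := {X | ∃ u ∈ F.V i, X - ((ρ u : Matrix (Fin n) (Fin n) ℤ) - 1) ∈ F.D (i + 1)}
  zero_mem' := ⟨1, one_mem _, by simp⟩
  add_mem' := by
    rintro X Y ⟨u, hu, hX⟩ ⟨v, hv, hY⟩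
    refine ⟨u * v, mul_mem hu hv, ?_⟩
    convert sub_mem (add_mem hX hY) (F.mul_sub_one_sub_mem hu hv) using 1
    abel
  neg_mem' := by
    rintro X ⟨u, hu, hX⟩
    refine ⟨u⁻¹, inv_mem hu, ?_⟩
    have := F.mul_sub_one_sub_mem hu (inv_mem hu)
    rw [mul_inv_cancel, map_one, Units.val_one, sub_self, zero_sub] at this
    convert sub_mem this hX using 1
    abel

/-- Elements of `V i` in a deep congruence subgroup are high powers modulo `V (i + 1)`. -/
theorem exists_level_pow (i : ℕ) : ∃ t : ℕ, t ≠ 0 ∧ ∀ c : ℕ, c ≠ 0 → ∀ u ∈ F.V i,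
    ρ u ∈ congruenceSubgroup n (c * t) → ∃ v ∈ F.V i, u⁻¹ * v ^ c ∈ F.V (i + 1) := by
  obtain ⟨t, ht, htA⟩ := exists_ne_zero_nsmul_mem (F.graded i)
  refine ⟨t, ht, fun c hc u hu hcong => ?_⟩
  obtain ⟨Y, hY⟩ := mem_congruenceSubgroup_iff.1 hcong
  rw [natCast_zsmul] at hY
  -- The matrix `(c * t) • Y` is `u - 1`. The torsion bound realises `t • Y` by some `v`, and `v ^
  -- c` then approximates `u`.
  have hmem : (c * t) • Y ∈ F.graded i := hY ▸ ⟨u, hu, by simp⟩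
  obtain ⟨v, hv, hvY⟩ := htA (c * t) Y (mul_ne_zero hc ht) hmem
  refine ⟨v, hv, (F.inv_mul_mem_iff hu (pow_mem hv c)).2 ?_⟩
  convert sub_mem (F.pow_sub_one_sub_mem hv c) (nsmul_mem hvY c) using 1
  rw [nsmul_sub (t • Y), smul_smul, ← hY]
  abel

theorem exists_level_approx [U.Normal] {e : ℕ} (he : e ≠ 0) (hU : ∀ g : G, g ^ e ∈ U) (i : ℕ) :
    ∀ m : ℕ, m ≠ 0 → ∃ m' : ℕ, m' ≠ 0 ∧ m ∣ m' ∧ ∀ g : G,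
      ρ (g ^ e) ∈ congruenceSubgroup n m' →
      ∃ d : G, ρ (g⁻¹ * d) ∈ congruenceSubgroup n m ∧ d ^ e ∈ F.V i := by
  induction i with
  | zero =>
    exact fun m hm => ⟨m, hm, dvd_rfl, fun g _ => ⟨g, by simp, F.mem_V_zero (hU g)⟩⟩
  | succ i ih =>
    intro m hm
    have : NeZero m := ⟨hm⟩
    obtain ⟨t, ht, hroot⟩ := F.exists_level_pow i
    set r := Nat.card (GL (Fin n) (ZMod m))
    have hr0 : r ≠ 0 := Nat.card_pos.ne'
    have hc : r * e ≠ 0 := mul_ne_zero hr0 he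
    -- The factor `r * e * t` yields an `(r * e)`-th root `v`; its power `v ^ r` lies in level `m`.
    -- The factor `m` keeps `d` congruent to `g`.
    obtain ⟨m', hm', hdvd, happ⟩ := ih (r * e * t * m) (by positivity)
    refine ⟨m', hm', (dvd_mul_left _ _).trans hdvd, fun g hg => ?_⟩
    obtain ⟨d, hgd, hd⟩ := happ g hg
    have hde : ρ (d ^ e) ∈ congruenceSubgroup n (r * e * t * m) := by
      have hg' := congruenceSubgroup_le_of_dvd hdvd hg
      rw [congruenceSubgroup, MonoidHom.mem_ker] at hg' hgd ⊢
      rw [map_mul, map_mul, map_inv, map_inv, inv_mul_eq_one] at hgd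
      rwa [map_pow, map_pow, ← hgd, ← map_pow, ← map_pow]
    obtain ⟨v, hv, hvd⟩ := hroot (r * e) hc _ hd
      (congruenceSubgroup_le_of_dvd (dvd_mul_right _ _) hde)
    rw [pow_mul] at hvd
    refine ⟨d * (v ^ r)⁻¹, ?_, F.div_pow_mem he (pow_mem hv r) hvd⟩
    rw [← mul_assoc, map_mul, map_inv, map_pow]
    exact mul_mem (congruenceSubgroup_le_of_dvd (dvd_mul_left _ _) hgd)
      (inv_mem (pow_card_mem_congruenceSubgroup _))

/-- In a torsion free group, `e`-th powers close to the identity have `e`-th roots close to the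
identity. -/
theorem exists_level_of_torsionFree [U.Normal] (F : UnipotentFiltration ρ U)
    (hρ : Function.Injective ρ) (hG : TorsionFreeGroup G) {e : ℕ} (he : e ≠ 0) (hU : ∀ g : G, g ^ e ∈ U) {m : ℕ}
    (hm : m ≠ 0) : ∃ m' : ℕ, m' ≠ 0 ∧ m ∣ m' ∧ ∀ g : G,
      ρ (g ^ e) ∈ congruenceSubgroup n m' → ρ g ∈ congruenceSubgroup n m := by
  obtain ⟨m', hm', hdvd, h⟩ := F.exists_level_approx he hU F.length m hm
  refine ⟨m', hm', hdvd, fun g hg => ?_⟩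
  obtain ⟨d, hgd, hd⟩ := h g hg
  have hde : d ^ e = 1 := by
    apply hρ
    rw [map_one]
    exact Units.ext (sub_eq_zero.1 (F.eq_zero _ hd.2))
  have hd1 : d = 1 := hG d (isOfFinOrder_iff_pow_eq_one.2 ⟨e, Nat.pos_of_ne_zero he, hde⟩)
  rw [hd1, mul_one, map_inv] at hgd
  exact inv_mem_iff.1 hgd

end UnipotentFiltration

/-! ### The filtration by powers of the augmentation -/

/-- Matrices supported on the entries `(i, j)` with `i + k ≤ j`. -/
def upperBand (n k : ℕ) : Submodule ℂ (Matrix (Fin n) (Fin n) ℂ) where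
  carrier := {M | ∀ i j : Fin n, (j : ℕ) < i + k → M i j = 0}
  zero_mem' := by intro i j _; rfl
  add_mem' := by
    intro M N hM hN i j h
    rw [Matrix.add_apply, hM i j h, hN i j h, add_zero]
  smul_mem' := by
    intro c M hM i j h
    rw [Matrix.smul_apply, hM i j h, smul_zero]

theorem mul_mem_upperBand {n k l : ℕ} {M N : Matrix (Fin n) (Fin n) ℂ}
    (hM : M ∈ upperBand n k) (hN : N ∈ upperBand n l) : M * N ∈ upperBand n (k + l) := by
  intro i j h
  rw [Matrix.mul_apply]
  refine Finset.sum_eq_zero fun a _ => ?_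
  by_cases ha : (a : ℕ) < i + k
  · rw [hM i a ha, zero_mul]
  · rw [hN a j (by omega), mul_zero]

theorem pow_le_upperBand {n : ℕ} {J : Submodule ℂ (Matrix (Fin n) (Fin n) ℂ)}
    (hJ : J ≤ upperBand n 1) (k : ℕ) : J ^ (k + 1) ≤ upperBand n (k + 1) := by
  induction k with
  | zero => simpa using hJ
  | succ k ih =>
    rw [pow_succ, Submodule.mul_le]
    exact fun M hM N hN => mul_mem_upperBand (ih hM) (hJ hN)

theorem IsUpperUnitriangular.sub_one_mem_upperBand {n : ℕ} {M : Matrix (Fin n) (Fin n) ℂ}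
    (hM : IsUpperUnitriangular M) : M - 1 ∈ upperBand n 1 := by
  intro i j h
  rcases (show j ≤ i by rw [Fin.le_def]; omega).eq_or_lt with rfl | hlt
  · simp [hM.2]
  · simp [hM.1 hlt, hlt.ne']

/-- Conjugation by an invertible matrix. -/
noncomputable def conjAlgEquiv {n : ℕ} (g : GL (Fin n) ℂ) :
    Matrix (Fin n) (Fin n) ℂ ≃ₐ[ℂ] Matrix (Fin n) (Fin n) ℂ :=
  MulSemiringAction.toAlgEquiv ℂ _ (ConjAct.toConjAct g)

theorem conjAlgEquiv_apply {n : ℕ} (g : GL (Fin n) ℂ) (x : Matrix (Fin n) (Fin n) ℂ) :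
    conjAlgEquiv g x = (g : Matrix (Fin n) (Fin n) ℂ) * x *
      ((g⁻¹ : GL (Fin n) ℂ) : Matrix (Fin n) (Fin n) ℂ) := rfl

/-- The span of the matrices `u - 1` for `u` in a subgroup of invertible matrices. -/
def augmentation {n : ℕ} (H : Subgroup (GL (Fin n) ℂ)) :
    Submodule ℂ (Matrix (Fin n) (Fin n) ℂ) :=
  Submodule.span ℂ ((fun u : GL (Fin n) ℂ => (u : Matrix (Fin n) (Fin n) ℂ) - 1) '' H)

theorem sub_one_mem_augmentation {n : ℕ} {H : Subgroup (GL (Fin n) ℂ)} {u : GL (Fin n) ℂ}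
    (hu : u ∈ H) : (u : Matrix (Fin n) (Fin n) ℂ) - 1 ∈ augmentation H :=
  Submodule.subset_span ⟨u, hu, rfl⟩

theorem augmentation_mul_le {n : ℕ} (H : Subgroup (GL (Fin n) ℂ)) :
    augmentation H * augmentation H ≤ augmentation H := by
  nth_rw 1 2 [augmentation]
  rw [Submodule.span_mul_span, Submodule.span_le]
  rintro _ ⟨_, ⟨u, hu, rfl⟩, _, ⟨v, hv, rfl⟩, rfl⟩
  have : ((u : Matrix (Fin n) (Fin n) ℂ) - 1) * ((v : Matrix (Fin n) (Fin n) ℂ) - 1) =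
      (((u * v : GL (Fin n) ℂ) : Matrix (Fin n) (Fin n) ℂ) - 1) -
      ((u : Matrix (Fin n) (Fin n) ℂ) - 1) - ((v : Matrix (Fin n) (Fin n) ℂ) - 1) := by
    rw [Units.val_mul]; noncomm_ring
  simp only [this, SetLike.mem_coe]
  exact sub_mem (sub_mem (sub_one_mem_augmentation (mul_mem hu hv))
    (sub_one_mem_augmentation hu)) (sub_one_mem_augmentation hv)

theorem conj_mem_augmentation_pow {n : ℕ} {H : Subgroup (GL (Fin n) ℂ)} {g : GL (Fin n) ℂ}
    (hg : ∀ u ∈ H, g * u * g⁻¹ ∈ H) (k : ℕ) {x : Matrix (Fin n) (Fin n) ℂ}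
    (hx : x ∈ augmentation H ^ k) : conjAlgEquiv g x ∈ augmentation H ^ k := by
  have hle : (augmentation H).map (conjAlgEquiv g).toAlgHom.toLinearMap ≤ augmentation H := by
    rw [augmentation, Submodule.map_span, Submodule.span_le]
    rintro _ ⟨_, ⟨u, hu, rfl⟩, rfl⟩
    have : conjAlgEquiv g ((u : Matrix (Fin n) (Fin n) ℂ) - 1) =
        ((g * u * g⁻¹ : GL (Fin n) ℂ) : Matrix (Fin n) (Fin n) ℂ) - 1 := by
      rw [map_sub, map_one, conjAlgEquiv_apply, Units.val_mul, Units.val_mul]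
    exact this ▸ sub_one_mem_augmentation (hg u hu)
  have h1 := Submodule.mem_map_of_mem (f := (conjAlgEquiv g).toAlgHom.toLinearMap) hx
  rw [Submodule.map_pow] at h1
  exact pow_le_pow_left' hle k h1

theorem IsUnipotentSubgroup.augmentation_pow_eq_zero {n : ℕ} {H : Subgroup (GL (Fin n) ℂ)}
    (hH : IsUnipotentSubgroup H) {x : Matrix (Fin n) (Fin n) ℂ}
    (hx : x ∈ augmentation H ^ (n + 1)) : x = 0 := by
  obtain ⟨g, hg⟩ := hH
  have hle : (augmentation H).map (conjAlgEquiv g).toAlgHom.toLinearMap ≤ upperBand n 1 := by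
    rw [augmentation, Submodule.map_span, Submodule.span_le]
    rintro _ ⟨_, ⟨u, hu, rfl⟩, rfl⟩
    have : conjAlgEquiv g ((u : Matrix (Fin n) (Fin n) ℂ) - 1) =
        ((g * u * g⁻¹ : GL (Fin n) ℂ) : Matrix (Fin n) (Fin n) ℂ) - 1 := by
      rw [map_sub, map_one, conjAlgEquiv_apply, Units.val_mul, Units.val_mul]
    exact this ▸ (hg u hu).sub_one_mem_upperBand
  have h1 := Submodule.mem_map_of_mem (f := (conjAlgEquiv g).toAlgHom.toLinearMap) hx
  rw [Submodule.map_pow] at h1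
  have h2 : conjAlgEquiv g x = 0 := by
    ext i j
    exact pow_le_upperBand hle n h1 i j (by omega)
  exact (map_eq_zero_iff _ (conjAlgEquiv g).injective).1 h2

/-- The entrywise inclusion of integer matrices in complex matrices. -/
def intToComplexMatrix (n : ℕ) : Matrix (Fin n) (Fin n) ℤ →+* Matrix (Fin n) (Fin n) ℂ :=
  (Int.castRingHom ℂ).mapMatrix

theorem intToComplexMatrix_injective (n : ℕ) : Function.Injective (intToComplexMatrix n) :=
  Matrix.map_injective Int.cast_injective

theorem intToComplexMatrix_coe {n : ℕ} (g : GL (Fin n) ℤ) :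
    intToComplexMatrix n g = (intToComplexGL n g : Matrix (Fin n) (Fin n) ℂ) := rfl

/-- The filtration by powers of the augmentation of a normal unipotent subgroup. -/
def IsUnipotentSubgroup.filtration {n : ℕ} {G : Type*} [Group G] {ρ : G →* GL (Fin n) ℤ}
    {U : Subgroup G} [hN : U.Normal]
    (hU : IsUnipotentSubgroup (U.map ((intToComplexGL n).comp ρ))) : UnipotentFiltration ρ U where
  -- The exponent is shifted because the zeroth power consists of the scalars. Pulling back a
  -- complex subspace makes `D i` saturated.
  D i := ((augmentation (U.map ((intToComplexGL n).comp ρ))) ^ (i + 1)).toAddSubgroup.comap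
    (intToComplexMatrix n : Matrix (Fin n) (Fin n) ℤ →+ Matrix (Fin n) (Fin n) ℂ)
  sub_one_mem u hu := by
    change intToComplexMatrix n _ ∈ augmentation (U.map ((intToComplexGL n).comp ρ)) ^ (0 + 1)
    rw [zero_add, pow_one, map_sub, map_one, intToComplexMatrix_coe]
    exact sub_one_mem_augmentation ⟨u, hu, rfl⟩
  succ_le i x hx := by
    refine (?_ : augmentation (U.map ((intToComplexGL n).comp ρ)) ^ (i + 1 + 1) ≤
      augmentation (U.map ((intToComplexGL n).comp ρ)) ^ (i + 1)) hx
    rw [pow_succ, pow_succ, mul_assoc]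
    exact mul_le_mul_right (augmentation_mul_le _) _
  mul_mem_succ i x hx y hy := by
    change intToComplexMatrix n _ ∈ augmentation (U.map ((intToComplexGL n).comp ρ)) ^ (i + 1 + 1)
    rw [map_mul, pow_succ]
    exact Submodule.mul_mem_mul hx (by simpa using hy)
  conj_mem i g x hx := by
    change intToComplexMatrix n _ ∈ augmentation (U.map ((intToComplexGL n).comp ρ)) ^ (i + 1)
    rw [map_mul, map_mul, intToComplexMatrix_coe, intToComplexMatrix_coe, map_inv, map_inv]
    refine conj_mem_augmentation_pow (g := intToComplexGL n (ρ g)) ?_ _ hx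
    rintro _ ⟨u, hu, rfl⟩
    exact ⟨g * u * g⁻¹, hN.conj_mem u hu g, by simp⟩
  mem_of_nsmul_mem i c x hc hx := by
    change intToComplexMatrix n _ ∈ augmentation (U.map ((intToComplexGL n).comp ρ)) ^ (i + 1) at hx
    change intToComplexMatrix n _ ∈ augmentation (U.map ((intToComplexGL n).comp ρ)) ^ (i + 1)
    rw [map_nsmul, ← Nat.cast_smul_eq_nsmul ℂ] at hx
    exact (Submodule.smul_mem_iff _ (Nat.cast_ne_zero.2 hc)).1 hx
  length := n
  eq_zero x hx :=
    (map_eq_zero_iff _ (intToComplexMatrix_injective n)).1 (hU.augmentation_pow_eq_zero hx)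

/-! ### The torsion free overgroup of finite index -/

theorem IsVirtuallyUnipotent.exists_normal {n : ℕ} {Γ : Subgroup (GL (Fin n) ℤ)}
    (hu : IsVirtuallyUnipotent (Γ.map (intToComplexGL n))) :
    ∃ U : Subgroup Γ, U.Normal ∧ U.FiniteIndex ∧
      IsUnipotentSubgroup (U.map ((intToComplexGL n).comp Γ.subtype)) := by
  obtain ⟨H, hH, hfin, g, hg⟩ := hu
  have hfi : (H.comap ((intToComplexGL n).comp Γ.subtype)).FiniteIndex := by
    rw [Subgroup.finiteIndex_iff, Subgroup.index_comap, MonoidHom.range_comp,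
      Subgroup.range_subtype]
    exact hfin.relIndex_ne_zero
  refine ⟨(H.comap ((intToComplexGL n).comp Γ.subtype)).normalCore, inferInstance,
    inferInstance, g, ?_⟩
  rintro _ ⟨u, hu, rfl⟩
  exact hg _ (Subgroup.normalCore_le (H.comap ((intToComplexGL n).comp Γ.subtype)) hu)

theorem mainTheorem2 (n : ℕ) (Γ : Subgroup (GL (Fin n) ℤ))
    (hΓ : TorsionFreeGroup Γ) (hu : IsVirtuallyUnipotent (Γ.map (intToComplexGL n))) :
    ∃ Λ₀ : Subgroup (GL (Fin n) ℤ), Γ ≤ Λ₀ ∧ Λ₀.FiniteIndex ∧ TorsionFreeGroup Λ₀ := by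
  obtain ⟨U, hN, hfi, hU⟩ := hu.exists_normal
  set r := Nat.card (GL (Fin n) (ZMod 3))
  have hr0 : r ≠ 0 := Nat.card_pos.ne'
  -- The index puts `e`-th powers of `Γ` in `U`; the factor `r` kills torsion in `GL(n, ℤ)`.
  have he : r * U.index ≠ 0 := mul_ne_zero hr0 hfi.index_ne_zero
  have hpow : ∀ g : Γ, g ^ (r * U.index) ∈ U := fun g => by
    rw [mul_comm, pow_mul]; exact pow_mem (U.pow_index_mem g) r
  obtain ⟨m, hm, hdvd, hlevel⟩ := hU.filtration.exists_level_of_torsionFree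
    Γ.subtype_injective hΓ he hpow (m := 3) (by norm_num)
  have : NeZero m := ⟨hm⟩
  refine ⟨Γ ⊔ congruenceSubgroup n m, le_sup_left,
    Subgroup.finiteIndex_of_le (le_sup_right : congruenceSubgroup n m ≤ _), ?_⟩
  rintro ⟨x, hx⟩ hfin
  obtain ⟨k, hk, hxk⟩ := isOfFinOrder_iff_pow_eq_one.1 hfin
  replace hxk : x ^ k = 1 := congrArg Subtype.val hxk
  have hxr : x ^ r = 1 := eq_one_of_mem_congruenceSubgroup_three k hk.ne' _
    (pow_card_mem_congruenceSubgroup x) (by rw [← pow_mul, mul_comm, pow_mul, hxk, one_pow])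
  obtain ⟨γ, hγ, l, hl, rfl⟩ := Subgroup.mem_sup_of_normal_right.1 hx
  have hγe : γ ^ (r * U.index) ∈ congruenceSubgroup n m := by
    have h1 : (γ * l) ^ (r * U.index) = 1 := by rw [pow_mul, hxr, one_pow]
    rw [congruenceSubgroup, MonoidHom.mem_ker] at hl ⊢
    simpa [hl] using congrArg (Matrix.GeneralLinearGroup.map (Int.castRingHom (ZMod m))) h1
  have hγ3 : γ ∈ congruenceSubgroup n 3 := hlevel ⟨γ, hγ⟩ hγe
  have hx3 := mul_mem hγ3 (congruenceSubgroup_le_of_dvd hdvd hl)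
  exact Subtype.ext (eq_one_of_mem_congruenceSubgroup_three k hk.ne' _ hx3 hxk)
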